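/- Let $\tilde S,\tilde L\in\mathbb R^{n\times n}$ be skew symmetric and let $C=\tilde S+\tilde L$. Let $d=\deg_{\max}(\tilde S)$ be the largest number of nonzero entries in a row or a column of $\tilde S$, and let $\iota=\mathrm{inc}(\tilde L)=\max_k\|UU^Te_k\|_2$, where $\tilde L=U\Sigma V^T$ is a compact singular value decomposition (so that $UU^T$ is the orthogonal projection onto the column space of $\tilde L$) and $e_1,\dots,e_n$ is the standard basis of $\mathbb R^n$. Suppose that $d\,\iota<\frac1{12}$. Then the interval $$\left(\frac{2\iota}{1-8d\iota},\ \frac{1-6d\iota}{d}\right)$$ (with right end $+\infty$ if $d=0$) is nonempty, and for every $\gamma$ in it, $(\tilde S,\tilde L)$ is the unique optimal solution of the convex program $$\min_{S,L\in\mathbb R^{n\times n}}\ \gamma\|S\|_1+\|L\|_*\quad\text{subject to}\quad S+L=C,\ \ S+S^T=0,\ \ L+L^T=0,$$ where $\|S\|_1=\sum_{i,j}|S_{ij}|$ and $\|L\|_*$ is the nuclear norm, the sum of the singular values of $L$. -/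

import Mathlib

namespace SparseLowRank

/-- A real square matrix is skew symmetric: `M + Mᵀ = 0`. -/
def IsSkew {n : ℕ} (M : Matrix (Fin n) (Fin n) ℝ) : Prop :=
  M + M.transpose = 0

/-- The entrywise `ℓ₁` norm, the sum of the absolute values of all entries. -/
noncomputable def l1Norm {n : ℕ} (M : Matrix (Fin n) (Fin n) ℝ) : ℝ :=
  ∑ i, ∑ j, |M i j|

/-- The nuclear norm, the sum of all singular values (with multiplicity), where the matrix acts on
Euclidean space. -/
noncomputable def nuclearNorm {n : ℕ} (M : Matrix (Fin n) (Fin n) ℝ) : ℝ :=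
  ∑ i : Fin n, (Matrix.toEuclideanLin M).singularValues (i : ℕ)

/-- The maximal number of nonzero entries in a row or a column of `M`. -/
noncomputable def degMax {n : ℕ} (M : Matrix (Fin n) (Fin n) ℝ) : ℕ :=
  max (Finset.univ.sup fun i : Fin n => (Finset.univ.filter fun j : Fin n => M i j ≠ 0).card)
    (Finset.univ.sup fun j : Fin n => (Finset.univ.filter fun i : Fin n => M i j ≠ 0).card)

/-- The maximum incoherence `max_k ‖P e_k‖₂` of the column space of `M`, where `P` is the orthogonal
projection onto that column space. For a compact singular value decomposition `M = U Σ Vᵀ` one has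
`P = U Uᵀ`, see `IsCompactSVD.inc_eq`. -/
noncomputable def inc {n : ℕ} (M : Matrix (Fin n) (Fin n) ℝ) : ℝ :=
  ⨆ k : Fin n,
    ‖(LinearMap.range (Matrix.toEuclideanLin M)).starProjection (EuclideanSpace.single k (1 : ℝ))‖

/-- `M = U diag(σ) Vᵀ` is a compact singular value decomposition of `M`. -/
structure IsCompactSVD {n r : ℕ} (M : Matrix (Fin n) (Fin n) ℝ) (U : Matrix (Fin n) (Fin r) ℝ)
    (σ : Fin r → ℝ) (V : Matrix (Fin n) (Fin r) ℝ) : Prop where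
  orthoU : U.transpose * U = 1
  orthoV : V.transpose * V = 1
  pos : ∀ i, 0 < σ i
  anti : Antitone σ
  eq : M = U * Matrix.diagonal σ * V.transpose

/-- The incoherence is `max_k ‖U Uᵀ e_k‖₂` for every compact singular value decomposition. -/
theorem IsCompactSVD.inc_eq {n r : ℕ} {M : Matrix (Fin n) (Fin n) ℝ}
    {U : Matrix (Fin n) (Fin r) ℝ} {σ : Fin r → ℝ} {V : Matrix (Fin n) (Fin r) ℝ}
    (h : IsCompactSVD M U σ V) :
    inc M = ⨆ k : Fin n,
      ‖Matrix.toEuclideanLin (U * U.transpose) (EuclideanSpace.single k (1 : ℝ))‖ := by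
  have hUM : U * U.transpose * M = M := by
    rw [h.eq]
    calc U * U.transpose * (U * Matrix.diagonal σ * V.transpose)
        = U * (U.transpose * U) * Matrix.diagonal σ * V.transpose := by
          simp only [Matrix.mul_assoc]
      _ = _ := by rw [h.orthoU, Matrix.mul_one]
  have hU : M * (V * Matrix.diagonal (fun i => (σ i)⁻¹)) = U := by
    rw [h.eq]
    calc U * Matrix.diagonal σ * V.transpose * (V * Matrix.diagonal (fun i => (σ i)⁻¹))
        = U * (Matrix.diagonal σ * (V.transpose * V) * Matrix.diagonal (fun i => (σ i)⁻¹)) := by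
          simp only [Matrix.mul_assoc]
      _ = U := by
          rw [h.orthoV, Matrix.mul_one, Matrix.diagonal_mul_diagonal]
          have : (fun i => σ i * (σ i)⁻¹) = fun _ => (1 : ℝ) :=
            funext fun i => mul_inv_cancel₀ (h.pos i).ne'
          rw [this, Matrix.diagonal_one, Matrix.mul_one]
  unfold inc
  congr 1
  funext k
  congr 1
  refine Submodule.eq_starProjection_of_mem_of_inner_eq_zero ?_ ?_
  · refine ⟨WithLp.toLp 2
      ((V * Matrix.diagonal (fun i => (σ i)⁻¹) * U.transpose).mulVec (Pi.single k 1)), ?_⟩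
    simp only [Matrix.toLpLin_apply, PiLp.ofLp_single, Matrix.mulVec_mulVec]
    rw [← Matrix.mul_assoc, hU]
  · rintro _ ⟨x, rfl⟩
    have hT : M.transpose * (U * U.transpose) = M.transpose := by
      have := congrArg Matrix.transpose hUM
      simpa [Matrix.transpose_mul, Matrix.mul_assoc] using this
    simp only [Matrix.toLpLin_apply, EuclideanSpace.inner_eq_star_dotProduct, WithLp.ofLp_sub,
      PiLp.ofLp_single, star_trivial]
    rw [dotProduct_comm, Matrix.dotProduct_mulVec, ← Matrix.mulVec_transpose, Matrix.mulVec_sub,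
      Matrix.mulVec_mulVec, hT, sub_self, zero_dotProduct]

/-- The feasible set of the convex program for the data matrix `C`. -/
def feasibleSet {n : ℕ} (C : Matrix (Fin n) (Fin n) ℝ) :
    Set (Matrix (Fin n) (Fin n) ℝ × Matrix (Fin n) (Fin n) ℝ) :=
  {p | p.1 + p.2 = C ∧ IsSkew p.1 ∧ IsSkew p.2}

/-- The objective `γ ‖S‖₁ + ‖L‖_*` of the convex program. -/
noncomputable def objective {n : ℕ} (γ : ℝ)
    (p : Matrix (Fin n) (Fin n) ℝ × Matrix (Fin n) (Fin n) ℝ) : ℝ :=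
  γ * l1Norm p.1 + nuclearNorm p.2

/-- The set of all optimal solutions (the `argmin`) of the convex program. -/
def optimalSet {n : ℕ} (γ : ℝ) (C : Matrix (Fin n) (Fin n) ℝ) :
    Set (Matrix (Fin n) (Fin n) ℝ × Matrix (Fin n) (Fin n) ℝ) :=
  {p | p ∈ feasibleSet C ∧ ∀ q ∈ feasibleSet C, objective γ p ≤ objective γ q}

/-- The open interval `(2 inc(L) / (1 - 8 deg(S) inc(L)), (1 - 6 deg(S) inc(L)) / deg(S))`, whose
right end is read as `+∞` when `deg(S) = 0`. -/
def penaltyRange {n : ℕ} (S L : Matrix (Fin n) (Fin n) ℝ) : Set ℝ :=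
  {γ | 2 * inc L / (1 - 8 * degMax S * inc L) < γ ∧
    (degMax S ≠ 0 → γ < (1 - 6 * degMax S * inc L) / degMax S)}

end SparseLowRank

/-! The proof is by convex duality. Let `P` project onto the column space of `L₀`, and let `G` be
its polar factor. Since `L₀` is skew, its row and column spaces coincide, so `P` acts on both sides
of `L₀` and `G`, and the tangent space is `T = {P A + B P}`.

A certificate is a matrix `Q` that is a subgradient of both terms: `Q = γ sign S₀` on the support of
`S₀` and `|Q| < γ` off it, while `Q - G` is orthogonal to `T` with operator norm below 1. Passing to
`(S₀ + D, L₀ - D)` changes the two terms by at least `⟨Q, D⟩` and `-⟨Q, D⟩`. By the strict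
inequalities, the total increase is strict unless `D` is supported on the support of `S₀` and lies
in `T` (`objective_lt_of_dual_certificate`).

With `d = degMax S₀` and `ι = inc L₀`, two estimates compare the norms: `‖Z‖ ≤ d max|Z|` for `Z` on
the support (`norm_le_of_sparse`), and `max|N| ≤ 2ι‖N‖` for `N` in `T` (`abs_tangentProj_le`). They
make the two spaces transversal, so `D = 0`, and they bound the certificate built in
`exists_dual_certificate`. -/

namespace SparseLowRank

open Matrix
open scoped Matrix.Norms.L2Operator

/-! ### Operator norm inequalities. -/

section OperatorNorm

variable {n : ℕ}

theorem l2_opNorm_transpose (M : Matrix (Fin n) (Fin n) ℝ) : ‖Mᵀ‖ = ‖M‖ := by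
  rw [← conjTranspose_eq_transpose_of_trivial, l2_opNorm_conjTranspose]

theorem l2_opNorm_transpose_mul_self (M : Matrix (Fin n) (Fin n) ℝ) :
    ‖Mᵀ * M‖ = ‖M‖ * ‖M‖ := by
  rw [← conjTranspose_eq_transpose_of_trivial, l2_opNorm_conjTranspose_mul_self]

theorem norm_toEuclideanCLM_apply_le (M : Matrix (Fin n) (Fin n) ℝ)
    (x : EuclideanSpace ℝ (Fin n)) :
    ‖toEuclideanCLM (n := Fin n) (𝕜 := ℝ) M x‖ ≤ ‖M‖ * ‖x‖ := by
  rw [← l2_opNorm_toEuclideanCLM]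
  exact ContinuousLinearMap.le_opNorm _ _

theorem l2_opNorm_le_bound (M : Matrix (Fin n) (Fin n) ℝ) {c : ℝ} (hc : 0 ≤ c)
    (h : ∀ x, ‖toEuclideanCLM (n := Fin n) (𝕜 := ℝ) M x‖ ≤ c * ‖x‖) : ‖M‖ ≤ c := by
  rw [← l2_opNorm_toEuclideanCLM]
  exact ContinuousLinearMap.opNorm_le_bound _ hc h

theorem sum_sq_col_le (M : Matrix (Fin n) (Fin n) ℝ) (j : Fin n) :
    ∑ k, M k j ^ 2 ≤ ‖M‖ ^ 2 := by
  have h := norm_toEuclideanCLM_apply_le M (EuclideanSpace.single j (1 : ℝ))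
  have h1 : ‖EuclideanSpace.single j (1 : ℝ)‖ = 1 := by simp
  rw [h1, mul_one] at h
  have h2 := pow_le_pow_left₀ (norm_nonneg _) h 2
  rw [EuclideanSpace.norm_sq_eq] at h2
  simpa [ofLp_toEuclideanCLM] using h2

theorem abs_sum_mul_le {ι : Type*} [Fintype ι] {f g : ι → ℝ} {a b : ℝ} (ha : 0 ≤ a) (hb : 0 ≤ b)
    (hf : ∑ k, f k ^ 2 ≤ a ^ 2) (hg : ∑ k, g k ^ 2 ≤ b ^ 2) : |∑ k, f k * g k| ≤ a * b := by
  refine abs_le_of_sq_le_sq ?_ (mul_nonneg ha hb)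
  calc (∑ k, f k * g k) ^ 2 ≤ (∑ k, f k ^ 2) * ∑ k, g k ^ 2 :=
        Finset.sum_mul_sq_le_sq_mul_sq _ _ _
    _ ≤ a ^ 2 * b ^ 2 := mul_le_mul hf hg (Finset.sum_nonneg fun _ _ => sq_nonneg _) (sq_nonneg _)
    _ = (a * b) ^ 2 := by ring

/-- An orthogonal projection matrix has operator norm at most one. -/
theorem norm_le_one_of_symm_of_idem {P : Matrix (Fin n) (Fin n) ℝ} (hsym : Pᵀ = P)
    (hidem : P * P = P) : ‖P‖ ≤ 1 := by
  have h := l2_opNorm_transpose_mul_self P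
  rw [hsym, hidem] at h
  nlinarith [norm_nonneg P]

/-- Schur's test for a matrix with at most `d` nonzero entries in each row and column. -/
theorem norm_le_of_sparse {Z S : Matrix (Fin n) (Fin n) ℝ} {a : ℝ} (ha : 0 ≤ a)
    (hZ : ∀ i j, |Z i j| ≤ a) (hsupp : ∀ i j, S i j = 0 → Z i j = 0) :
    ‖Z‖ ≤ degMax S * a := by
  have hrow : ∀ i, ∑ j, (if S i j ≠ 0 then (1 : ℝ) else 0) ^ 2 ≤ degMax S := by
    intro i
    have h : (Finset.univ.filter fun j : Fin n => S i j ≠ 0).card ≤ degMax S :=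
      le_max_of_le_left (Finset.le_sup
        (f := fun i : Fin n => (Finset.univ.filter fun j : Fin n => S i j ≠ 0).card)
        (Finset.mem_univ i))
    have h' : ((Finset.univ.filter fun j : Fin n => S i j ≠ 0).card : ℝ) ≤ degMax S := by
      exact_mod_cast h
    simpa [ite_pow, Finset.sum_ite] using h'
  have hcol : ∀ j, ∑ i, (if S i j ≠ 0 then (1 : ℝ) else 0) ≤ degMax S := by
    intro j
    have h : (Finset.univ.filter fun i : Fin n => S i j ≠ 0).card ≤ degMax S :=
      le_max_of_le_right (Finset.le_sup
        (f := fun j : Fin n => (Finset.univ.filter fun i : Fin n => S i j ≠ 0).card)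
        (Finset.mem_univ j))
    have h' : ((Finset.univ.filter fun i : Fin n => S i j ≠ 0).card : ℝ) ≤ degMax S := by
      exact_mod_cast h
    simpa [Finset.sum_ite] using h'
  refine l2_opNorm_le_bound _ (by positivity) fun x => ?_
  refine le_of_sq_le_sq ?_ (by positivity)
  rw [mul_pow, EuclideanSpace.norm_sq_eq, EuclideanSpace.norm_sq_eq]
  simp only [ofLp_toEuclideanCLM, Real.norm_eq_abs, sq_abs, mulVec, dotProduct]
  calc ∑ i, (∑ j, Z i j * x j) ^ 2
      -- Cauchy–Schwarz against the support indicator uses the row count; exchanging the sums then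
      -- uses the column count.
      ≤ ∑ i, (degMax S : ℝ) * ∑ j, a ^ 2 * ((if S i j ≠ 0 then 1 else 0) * x j ^ 2) := by
        refine Finset.sum_le_sum fun i _ => ?_
        calc (∑ j, Z i j * x j) ^ 2
            = (∑ j, (if S i j ≠ 0 then (1 : ℝ) else 0) * (Z i j * x j)) ^ 2 := by
              congr 1
              refine Finset.sum_congr rfl fun j _ => ?_
              by_cases h : S i j = 0
              · simp [h, hsupp i j h]
              · simp [h]
          _ ≤ (∑ j, (if S i j ≠ 0 then (1 : ℝ) else 0) ^ 2) * ∑ j, (Z i j * x j) ^ 2 :=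
              Finset.sum_mul_sq_le_sq_mul_sq _ _ _
          _ ≤ (degMax S : ℝ) * ∑ j, a ^ 2 * ((if S i j ≠ 0 then 1 else 0) * x j ^ 2) := by
              refine mul_le_mul (hrow i) (Finset.sum_le_sum fun j _ => ?_)
                (Finset.sum_nonneg fun _ _ => sq_nonneg _) (Nat.cast_nonneg _)
              by_cases h : S i j = 0
              · simp [h, hsupp i j h]
              · have := sq_le_sq' (abs_le.1 (hZ i j)).1 (abs_le.1 (hZ i j)).2
                simp only [ne_eq, h, not_false_eq_true, if_true, one_mul, mul_pow]
                exact mul_le_mul_of_nonneg_right this (sq_nonneg _)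
    _ = (degMax S : ℝ) * a ^ 2 * ∑ j, (∑ i, (if S i j ≠ 0 then (1 : ℝ) else 0)) * x j ^ 2 := by
        rw [← Finset.mul_sum, Finset.sum_comm, mul_assoc]
        congr 1
        rw [Finset.mul_sum]
        refine Finset.sum_congr rfl fun j _ => ?_
        rw [Finset.sum_mul, Finset.mul_sum]
    _ ≤ (degMax S : ℝ) * a ^ 2 * ∑ j, (degMax S : ℝ) * x j ^ 2 := by
        refine mul_le_mul_of_nonneg_left (Finset.sum_le_sum fun j _ => ?_) (by positivity)
        exact mul_le_mul_of_nonneg_right (hcol j) (sq_nonneg _)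
    _ = (degMax S * a) ^ 2 * ∑ j, x j ^ 2 := by rw [← Finset.mul_sum]; ring

/-- Contractions acting between complementary pairs of subspaces add up to a contraction. -/
theorem norm_add_le_one_of_block {P G W : Matrix (Fin n) (Fin n) ℝ} (hsym : Pᵀ = P)
    (hidem : P * P = P) (hPG : P * G = G) (hGP : G * P = G) (hPW : P * W = 0) (hWP : W * P = 0)
    (hG : ‖G‖ ≤ 1) (hW : ‖W‖ ≤ 1) : ‖G + W‖ ≤ 1 := by
  set T := toEuclideanCLM (n := Fin n) (𝕜 := ℝ) with hT
  have hinner : ∀ (A B : Matrix (Fin n) (Fin n) ℝ) (x y : EuclideanSpace ℝ (Fin n)),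
      Aᵀ * B = 0 → inner ℝ (T A x) (T B y) = 0 := by
    intro A B x y h
    have h1 : T Aᵀ = ContinuousLinearMap.adjoint (T A) := by
      rw [← conjTranspose_eq_transpose_of_trivial, ← star_eq_conjTranspose, map_star]; rfl
    rw [← ContinuousLinearMap.adjoint_inner_right, ← h1, ← mul_apply_eq_comp,
      ← map_mul, h]
    simp
  have hpyth : ∀ (A B : Matrix (Fin n) (Fin n) ℝ) (x : EuclideanSpace ℝ (Fin n)),
      Aᵀ * B = 0 → ‖T (A + B) x‖ ^ 2 = ‖T A x‖ ^ 2 + ‖T B x‖ ^ 2 := by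
    intro A B x h
    rw [map_add, _root_.add_apply, norm_add_sq_real, hinner A B x x h]
    ring
  refine l2_opNorm_le_bound _ zero_le_one fun x => ?_
  refine le_of_sq_le_sq ?_ (by positivity)
  have hGW : Gᵀ * W = 0 := by
    rw [← hPG, transpose_mul, hsym, Matrix.mul_assoc, hPW, Matrix.mul_zero]
  have hPP : Pᵀ * (1 - P) = 0 := by rw [hsym, mul_sub, hidem, mul_one, sub_self]
  have hx := hpyth P (1 - P) x hPP
  rw [add_sub_cancel, map_one, one_apply_eq_self] at hx
  -- `G` sees only `P x` and `W` only `(1 - P) x`, and their ranges are orthogonal, so Pythagoras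
  -- applies to both input and output.
  rw [hpyth G W x hGW, one_mul, hx]
  have h1 : ‖T G x‖ ≤ ‖T P x‖ := by
    have : T G x = T G (T P x) := by
      rw [← mul_apply_eq_comp, ← map_mul, hGP]
    rw [this]
    exact (norm_toEuclideanCLM_apply_le G _).trans
      (mul_le_of_le_one_left (norm_nonneg _) hG)
  have h2 : ‖T W x‖ ≤ ‖T (1 - P) x‖ := by
    have : T W x = T W (T (1 - P) x) := by
      rw [← mul_apply_eq_comp, ← map_mul, mul_sub, hWP, mul_one, sub_zero]
    rw [this]
    exact (norm_toEuclideanCLM_apply_le W _).trans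
      (mul_le_of_le_one_left (norm_nonneg _) hW)
  gcongr

end OperatorNorm

/-! ### Nuclear norm: duality and the polar factor. -/

section NuclearNorm

variable {n : ℕ}

/-- A matrix acquires orthogonal columns, with the singular values as their lengths, after
multiplication by a suitable orthogonal matrix. -/
theorem exists_right_singular_basis (M : Matrix (Fin n) (Fin n) ℝ) :
    ∃ (V : Matrix (Fin n) (Fin n) ℝ) (σ : Fin n → ℝ), Vᵀ * V = 1 ∧ V * Vᵀ = 1 ∧
      (∀ i, 0 ≤ σ i) ∧ Mᵀ * M * V = V * diagonal (fun i => σ i ^ 2) ∧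
      nuclearNorm M = ∑ i, σ i := by
  set T := toEuclideanLin M with hT
  have hn : Module.finrank ℝ (EuclideanSpace ℝ (Fin n)) = n := by simp
  -- The columns of `V` are eigenvectors of `MᵀM`, in the order of the singular values.
  set b := T.isSymmetric_adjoint_comp_self.eigenvectorBasis hn with hb
  have hV : (Matrix.of fun i j => b j i : Matrix (Fin n) (Fin n) ℝ)ᵀ *
      (Matrix.of fun i j => b j i) = 1 := by
    ext i j
    have h := orthonormal_iff_ite.1 b.orthonormal i j
    rw [EuclideanSpace.inner_eq_star_dotProduct] at h
    rw [mul_apply, one_apply, ← h]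
    simp [dotProduct, mul_comm]
  refine ⟨Matrix.of fun i j => b j i, fun i => T.singularValues i, hV,
    mul_eq_one_comm.1 hV, fun i => T.singularValues_nonneg i, ?_, rfl⟩
  have hadj : LinearMap.adjoint T = toEuclideanLin Mᵀ := by
    rw [← conjTranspose_eq_transpose_of_trivial, toEuclideanLin_conjTranspose_eq_adjoint]
  ext i j
  have h := T.isSymmetric_adjoint_comp_self.apply_eigenvectorBasis hn j
  rw [← T.sq_singularValues_fin hn, LinearMap.comp_apply, ← hb] at h
  replace h := (LinearMap.congr_fun hadj (T (b j))).symm.trans h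
  have h' := congrArg (fun x : EuclideanSpace ℝ (Fin n) => x i) h
  rw [mul_diagonal]
  simp only [hT, toLpLin_apply, mulVec_mulVec] at h'
  simpa [mulVec, dotProduct, mul_apply, mul_comm] using h'

/-- The nuclear norm is bounded below by pairing with contractions. -/
theorem trace_transpose_mul_le_nuclearNorm {Y : Matrix (Fin n) (Fin n) ℝ} (hY : ‖Y‖ ≤ 1)
    (M : Matrix (Fin n) (Fin n) ℝ) : (Yᵀ * M).trace ≤ nuclearNorm M := by
  obtain ⟨V, σ, hVV, hVV', hσ, hMV, hnuc⟩ := exists_right_singular_basis M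
  have hVnorm : ‖V‖ ≤ 1 := by
    have h := l2_opNorm_transpose_mul_self V
    have h1 : ‖(1 : Matrix (Fin n) (Fin n) ℝ)‖ ≤ 1 :=
      norm_le_one_of_symm_of_idem transpose_one (mul_one _)
    rw [hVV] at h
    nlinarith [norm_nonneg V]
  have hYV : ‖Y * V‖ ≤ 1 :=
    (norm_mul_le _ _).trans (mul_le_one₀ hY (norm_nonneg _) hVnorm)
  have hMVd : (M * V)ᵀ * (M * V) = diagonal fun i => σ i ^ 2 := by
    rw [transpose_mul, Matrix.mul_assoc, ← Matrix.mul_assoc Mᵀ, hMV, ← Matrix.mul_assoc, hVV,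
      Matrix.one_mul]
  -- In this basis the pairing splits into columns: those of `Y * V` have length at most 1, those of
  -- `M * V` have length `σ i`.
  have htr : (Yᵀ * M).trace = ((Y * V)ᵀ * (M * V)).trace := by
    rw [transpose_mul, Matrix.mul_assoc, trace_mul_comm Vᵀ, Matrix.mul_assoc, Matrix.mul_assoc,
      hVV', Matrix.mul_one]
  rw [htr, hnuc, trace]
  refine Finset.sum_le_sum fun i _ => ?_
  rw [diag_apply, mul_apply]
  simp only [transpose_apply]
  have h1 : ∑ k, (Y * V) k i ^ 2 ≤ 1 ^ 2 :=
    (sum_sq_col_le _ i).trans (pow_le_pow_left₀ (norm_nonneg _) hYV 2)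
  have h2 : ∑ k, (M * V) k i ^ 2 ≤ σ i ^ 2 := by
    have h := congrFun (congrFun hMVd i) i
    rw [mul_apply, diagonal_apply_eq] at h
    simp only [transpose_apply] at h
    rw [← h]
    exact le_of_eq (Finset.sum_congr rfl fun k _ => sq _)
  simpa using (le_abs_self _).trans (abs_sum_mul_le zero_le_one (hσ i) h1 h2)

/-- The polar factor of a matrix, the matrix `U Vᵀ` of a compact singular value decomposition. -/
theorem exists_polar_factor (M : Matrix (Fin n) (Fin n) ℝ) :
    ∃ G : Matrix (Fin n) (Fin n) ℝ, ‖G‖ ≤ 1 ∧ (Gᵀ * M).trace = nuclearNorm M ∧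
      (∃ A, G = M * A) ∧ ∃ A, G = A * M := by
  obtain ⟨V, σ, hVV, hVV', hσ, hMV, hnuc⟩ := exists_right_singular_basis M
  have hMM : Mᵀ * M = V * diagonal (fun i => σ i ^ 2) * Vᵀ := by
    rw [← hMV, Matrix.mul_assoc, hVV', Matrix.mul_one]
  have hconj : ∀ f g : Fin n → ℝ, (V * diagonal f * Vᵀ) * (V * diagonal g * Vᵀ) =
      V * diagonal (fun i => f i * g i) * Vᵀ := by
    intro f g
    calc (V * diagonal f * Vᵀ) * (V * diagonal g * Vᵀ)
        = V * (diagonal f * (Vᵀ * V) * diagonal g) * Vᵀ := by simp only [Matrix.mul_assoc]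
      _ = _ := by rw [hVV, Matrix.mul_one, diagonal_mul_diagonal]
  have hconjT : ∀ f : Fin n → ℝ, (V * diagonal f * Vᵀ)ᵀ = V * diagonal f * Vᵀ := by
    intro f
    simp [transpose_mul, Matrix.mul_assoc]
  have hGM : (M * (V * diagonal (fun i => (σ i)⁻¹) * Vᵀ))ᵀ * M =
      V * diagonal (fun i => σ i) * Vᵀ := by
    rw [transpose_mul, hconjT, Matrix.mul_assoc, hMM, hconj]
    congr 3
    funext i
    by_cases h : σ i = 0
    · simp [h]
    · field_simp
  -- `G = M (MᵀM)^(-1/2) = (M (MᵀM)^(-3/2) Mᵀ) M`. The convention `0⁻¹ = 0` makes these powers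
  -- pseudoinverses, and `GᵀG` a projection.
  refine ⟨M * (V * diagonal (fun i => (σ i)⁻¹) * Vᵀ), ?_, ?_, ⟨_, rfl⟩,
    ⟨M * (V * diagonal (fun i => (σ i)⁻¹ ^ 3) * Vᵀ) * Mᵀ, ?_⟩⟩
  · set G := M * (V * diagonal (fun i => (σ i)⁻¹) * Vᵀ)
    have hGG : Gᵀ * G = V * diagonal (fun i => σ i * (σ i)⁻¹) * Vᵀ := by
      rw [← Matrix.mul_assoc Gᵀ, hGM, hconj]
    have hle : ‖Gᵀ * G‖ ≤ 1 := by
      rw [hGG]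
      refine norm_le_one_of_symm_of_idem (hconjT _) ?_
      rw [hconj]
      congr 3
      funext i
      by_cases h : σ i = 0
      · simp [h]
      · field_simp
    rw [l2_opNorm_transpose_mul_self] at hle
    nlinarith [norm_nonneg G]
  · rw [hGM, trace_mul_comm, ← Matrix.mul_assoc, hVV, Matrix.one_mul, trace_diagonal, hnuc]
  · rw [Matrix.mul_assoc _ Mᵀ, hMM, Matrix.mul_assoc M, hconj]
    congr 4
    funext i
    by_cases h : σ i = 0
    · simp [h]
    · field_simp

end NuclearNorm

/-! ### Incoherence and the column space projection. -/

section ColumnSpace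

variable {n : ℕ}

theorem norm_starProjection_single_le_inc (M : Matrix (Fin n) (Fin n) ℝ) (k : Fin n) :
    ‖(LinearMap.range (toEuclideanLin M)).starProjection (EuclideanSpace.single k (1 : ℝ))‖
      ≤ inc M :=
  le_ciSup (f := fun k : Fin n => ‖(LinearMap.range (toEuclideanLin M)).starProjection
    (EuclideanSpace.single k (1 : ℝ))‖) (Set.finite_range _).bddAbove k

theorem inc_nonneg (M : Matrix (Fin n) (Fin n) ℝ) : 0 ≤ inc M :=
  Real.iSup_nonneg fun _ => norm_nonneg _

/-- The matrix of the orthogonal projection onto the column space. -/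
theorem exists_columnSpace_projection (M : Matrix (Fin n) (Fin n) ℝ) :
    ∃ P : Matrix (Fin n) (Fin n) ℝ, Pᵀ = P ∧ P * P = P ∧ P * M = M ∧
      ∀ j, ∑ k, P k j ^ 2 ≤ inc M ^ 2 := by
  set K := LinearMap.range (toEuclideanLin M) with hK
  set T := toEuclideanCLM (n := Fin n) (𝕜 := ℝ) with hT
  obtain ⟨P, hP⟩ : ∃ P, T P = K.starProjection := EquivLike.surjective T _
  have hinj : Function.Injective T := EquivLike.injective T
  refine ⟨P, hinj ?_, hinj ?_, hinj ?_, fun j => ?_⟩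
  · rw [← conjTranspose_eq_transpose_of_trivial, ← star_eq_conjTranspose, map_star, hP]
    exact isSelfAdjoint_starProjection K
  · rw [map_mul, hP]
    exact K.isIdempotentElem_starProjection
  · rw [map_mul, hP]
    ext1 x
    rw [mul_apply_eq_comp]
    exact Submodule.starProjection_eq_self_iff.2 ⟨x, rfl⟩
  · have h : ‖K.starProjection (EuclideanSpace.single j (1 : ℝ))‖ ^ 2 ≤ inc M ^ 2 :=
      pow_le_pow_left₀ (norm_nonneg _) (norm_starProjection_single_le_inc M j) 2
    rw [← hP, EuclideanSpace.norm_sq_eq] at h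
    simpa [hT, ofLp_toEuclideanCLM] using h

end ColumnSpace

/-! ### Support and tangent projections, and the certificate. -/

section Certificate

variable {n : ℕ}

/-- The largest absolute value of an entry. -/
noncomputable def maxEntry (M : Matrix (Fin n) (Fin n) ℝ) : ℝ :=
  -- The function type selects the sup norm; on matrices `‖·‖` is the operator norm here.
  ‖(fun i j => M i j : Fin n → Fin n → ℝ)‖

theorem maxEntry_nonneg (M : Matrix (Fin n) (Fin n) ℝ) : 0 ≤ maxEntry M :=
  norm_nonneg _

theorem abs_le_maxEntry (M : Matrix (Fin n) (Fin n) ℝ) (i j : Fin n) : |M i j| ≤ maxEntry M :=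
  (norm_le_pi_norm (fun j => M i j) j).trans (norm_le_pi_norm (fun i j => M i j) i)

theorem maxEntry_le {M : Matrix (Fin n) (Fin n) ℝ} {c : ℝ} (hc : 0 ≤ c)
    (h : ∀ i j, |M i j| ≤ c) : maxEntry M ≤ c :=
  (pi_norm_le_iff_of_nonneg hc).2 fun i => (pi_norm_le_iff_of_nonneg hc).2 fun j => h i j

/-- The projection onto the matrices supported where `S` is nonzero. -/
noncomputable def restrictSupport (S : Matrix (Fin n) (Fin n) ℝ) :
    Matrix (Fin n) (Fin n) ℝ →ₗ[ℝ] Matrix (Fin n) (Fin n) ℝ where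
  toFun M := Matrix.of fun i j => if S i j = 0 then 0 else M i j
  map_add' M N := by ext i j; by_cases h : S i j = 0 <;> simp [h]
  map_smul' c M := by ext i j; by_cases h : S i j = 0 <;> simp [h]

theorem restrictSupport_apply (S M : Matrix (Fin n) (Fin n) ℝ) (i j : Fin n) :
    restrictSupport S M i j = if S i j = 0 then 0 else M i j := rfl

/-- For an orthogonal projection `P`, the orthogonal projection onto the matrices
`P * A + B * P`. -/
noncomputable def tangentProj (P : Matrix (Fin n) (Fin n) ℝ) :
    Matrix (Fin n) (Fin n) ℝ →ₗ[ℝ] Matrix (Fin n) (Fin n) ℝ where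
  toFun M := P * M + (1 - P) * M * P
  map_add' M N := by noncomm_ring
  map_smul' c M := by simp [smul_add]

theorem tangentProj_apply (P M : Matrix (Fin n) (Fin n) ℝ) :
    tangentProj P M = P * M + (1 - P) * M * P := rfl

theorem sub_tangentProj (P M : Matrix (Fin n) (Fin n) ℝ) :
    M - tangentProj P M = (1 - P) * M * (1 - P) := by
  rw [tangentProj_apply]; noncomm_ring

theorem tangentProj_tangentProj {P : Matrix (Fin n) (Fin n) ℝ} (hidem : P * P = P)
    (M : Matrix (Fin n) (Fin n) ℝ) : tangentProj P (tangentProj P M) = tangentProj P M := by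
  have h : (1 - P) * P = 0 := by rw [sub_mul, one_mul, hidem, sub_self]
  have h' : P * (1 - P) = 0 := by rw [mul_sub, mul_one, hidem, sub_self]
  have h2 : tangentProj P M - tangentProj P (tangentProj P M) = 0 := by
    rw [sub_tangentProj, tangentProj_apply, mul_add, add_mul, ← mul_assoc (1 - P) P, h,
      ← mul_assoc (1 - P) _ P, mul_assoc _ P (1 - P), h']
    simp
  exact (sub_eq_zero.1 h2).symm

theorem one_sub_transpose {P : Matrix (Fin n) (Fin n) ℝ} (hsym : Pᵀ = P) :
    (1 - P)ᵀ = 1 - P := by rw [transpose_sub, transpose_one, hsym]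

theorem one_sub_mul_one_sub {P : Matrix (Fin n) (Fin n) ℝ} (hidem : P * P = P) :
    (1 - P) * (1 - P) = 1 - P := by
  rw [mul_sub, sub_mul, sub_mul, hidem]; simp

/-- Each of the two summands of `tangentProj` is a contraction of `M`, whence the factor 2. -/
theorem norm_tangentProj_le {P : Matrix (Fin n) (Fin n) ℝ} (hsym : Pᵀ = P) (hidem : P * P = P)
    (M : Matrix (Fin n) (Fin n) ℝ) : ‖tangentProj P M‖ ≤ 2 * ‖M‖ := by
  have h1 := norm_le_one_of_symm_of_idem hsym hidem
  have h2 := norm_le_one_of_symm_of_idem (one_sub_transpose hsym) (one_sub_mul_one_sub hidem)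
  have h3 : ‖P * M‖ ≤ ‖M‖ :=
    (norm_mul_le _ _).trans (mul_le_of_le_one_left (norm_nonneg _) h1)
  have h4 : ‖(1 - P) * M * P‖ ≤ ‖M‖ :=
    ((norm_mul_le _ _).trans (mul_le_of_le_one_right (norm_nonneg _) h1)).trans
      ((norm_mul_le _ _).trans (mul_le_of_le_one_left (norm_nonneg _) h2))
  rw [tangentProj_apply]
  linarith [norm_add_le (P * M) ((1 - P) * M * P)]

theorem norm_sub_tangentProj_le {P : Matrix (Fin n) (Fin n) ℝ} (hsym : Pᵀ = P)
    (hidem : P * P = P) (M : Matrix (Fin n) (Fin n) ℝ) : ‖M - tangentProj P M‖ ≤ ‖M‖ := by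
  have h2 := norm_le_one_of_symm_of_idem (one_sub_transpose hsym) (one_sub_mul_one_sub hidem)
  rw [sub_tangentProj]
  exact ((norm_mul_le _ _).trans (mul_le_of_le_one_right (norm_nonneg _) h2)).trans
    ((norm_mul_le _ _).trans (mul_le_of_le_one_left (norm_nonneg _) h2))

/-- The entries of a matrix in the tangent space are small compared with its operator norm. -/
theorem abs_tangentProj_le {P : Matrix (Fin n) (Fin n) ℝ} (hsym : Pᵀ = P) (hidem : P * P = P)
    {ι : ℝ} (hι : 0 ≤ ι) (hP : ∀ j, ∑ k, P k j ^ 2 ≤ ι ^ 2) {M : Matrix (Fin n) (Fin n) ℝ}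
    (hM : tangentProj P M = M) (i j : Fin n) : |M i j| ≤ 2 * ι * ‖M‖ := by
  have h2 := norm_le_one_of_symm_of_idem (one_sub_transpose hsym) (one_sub_mul_one_sub hidem)
  have hPsym : ∀ k, P i k = P k i := fun k => congrFun (congrFun hsym k) i
  -- This entry is the inner product of column `i` of `P` with column `j` of `M`; each of the two
  -- summands costs `ι * ‖M‖`.
  have h3 : |(P * M) i j| ≤ ι * ‖M‖ := by
    rw [mul_apply]
    simp only [hPsym]
    exact abs_sum_mul_le hι (norm_nonneg _) (hP i) (sum_sq_col_le M j)
  have h4 : |((1 - P) * M * P) i j| ≤ ‖M‖ * ι := by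
    have hle : ‖((1 - P) * M)ᵀ‖ ≤ ‖M‖ := by
      rw [l2_opNorm_transpose]
      exact (norm_mul_le _ _).trans (mul_le_of_le_one_left (norm_nonneg _) h2)
    rw [mul_apply]
    exact abs_sum_mul_le (norm_nonneg _) hι
      ((sum_sq_col_le ((1 - P) * M)ᵀ i).trans (pow_le_pow_left₀ (norm_nonneg _) hle 2)) (hP j)
  have h5 : M i j = (P * M) i j + ((1 - P) * M * P) i j :=
    congrFun (congrFun hM.symm i) j
  rw [h5]
  linarith [abs_add_le ((P * M) i j) (((1 - P) * M * P) i j)]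

/-- Transversality of the two tangent spaces. -/
theorem eq_zero_of_eq_restrictSupport_tangentProj {P S Z : Matrix (Fin n) (Fin n) ℝ}
    (hsym : Pᵀ = P) (hidem : P * P = P) {ι : ℝ} (hι : 0 ≤ ι)
    (hP : ∀ j, ∑ k, P k j ^ 2 ≤ ι ^ 2) (hd : degMax S * ι < 1 / 4)
    (hZ : Z = restrictSupport S (tangentProj P Z)) : Z = 0 := by
  have hentry : ∀ i j, Z i j = if S i j = 0 then 0 else tangentProj P Z i j := fun i j =>
    congrFun (congrFun hZ i) j
  have h1 : ‖Z‖ ≤ degMax S * maxEntry Z :=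
    norm_le_of_sparse (maxEntry_nonneg Z) (abs_le_maxEntry Z) fun i j h => by
      rw [hentry, if_pos h]
  have h2 : maxEntry Z ≤ 2 * ι * ‖tangentProj P Z‖ := by
    refine maxEntry_le (by positivity) fun i j => ?_
    rw [hentry]
    split_ifs
    · rw [abs_zero]; positivity
    · exact abs_tangentProj_le hsym hidem hι hP (tangentProj_tangentProj hidem Z) i j
  have h3 := norm_tangentProj_le hsym hidem Z
  -- Restriction after tangent projection contracts the largest entry by `4dι < 1`.
  have h4 : maxEntry Z ≤ 4 * (degMax S * ι) * maxEntry Z := by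
    calc maxEntry Z ≤ 2 * ι * (2 * (degMax S * maxEntry Z)) :=
          h2.trans (mul_le_mul_of_nonneg_left (h3.trans (by linarith)) (by positivity))
      _ = _ := by ring
  have h5 : maxEntry Z = 0 := by
    nlinarith [maxEntry_nonneg Z]
  ext i j
  have := abs_le_maxEntry Z i j
  rw [h5] at this
  simpa using this

theorem eq_zero_of_support_of_tangentProj {P S D : Matrix (Fin n) (Fin n) ℝ}
    (hsym : Pᵀ = P) (hidem : P * P = P) {ι : ℝ} (hι : 0 ≤ ι)
    (hP : ∀ j, ∑ k, P k j ^ 2 ≤ ι ^ 2) (hd : degMax S * ι < 1 / 4)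
    (hsupp : ∀ i j, S i j = 0 → D i j = 0) (hT : tangentProj P D = D) : D = 0 := by
  refine eq_zero_of_eq_restrictSupport_tangentProj (S := S) hsym hidem hι hP hd ?_
  ext i j
  rw [hT, restrictSupport_apply]
  split_ifs with h
  · exact hsupp i j h
  · rfl

/-- In finite dimension the injectivity given by transversality yields surjectivity, so no Neumann
series is needed. -/
theorem exists_eq_add_restrictSupport_tangentProj {P S : Matrix (Fin n) (Fin n) ℝ}
    (hsym : Pᵀ = P) (hidem : P * P = P) {ι : ℝ} (hι : 0 ≤ ι)
    (hP : ∀ j, ∑ k, P k j ^ 2 ≤ ι ^ 2) (hd : degMax S * ι < 1 / 4)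
    (R : Matrix (Fin n) (Fin n) ℝ) :
    ∃ Z, Z = R + restrictSupport S (tangentProj P Z) := by
  have hinj : Function.Injective
      (LinearMap.id - restrictSupport S ∘ₗ tangentProj P :
        Matrix (Fin n) (Fin n) ℝ →ₗ[ℝ] Matrix (Fin n) (Fin n) ℝ) := by
    rw [← LinearMap.ker_eq_bot, LinearMap.ker_eq_bot']
    intro Z hZ
    exact eq_zero_of_eq_restrictSupport_tangentProj hsym hidem hι hP hd (sub_eq_zero.1 hZ)
  obtain ⟨Z, hZ⟩ := LinearMap.injective_iff_surjective.1 hinj R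
  exact ⟨Z, by rw [← hZ]; simp⟩

/-- Existence of a strict dual certificate. -/
theorem exists_dual_certificate {P G S : Matrix (Fin n) (Fin n) ℝ} (hsym : Pᵀ = P)
    (hidem : P * P = P) {ι γ : ℝ} (hι : 0 ≤ ι) (hP : ∀ j, ∑ k, P k j ^ 2 ≤ ι ^ 2)
    (hPG : P * G = G) (hG : ‖G‖ ≤ 1) (hd : degMax S * ι < 1 / 12)
    (hγ : 2 * ι < γ * (1 - 8 * (degMax S * ι)))
    (hγ' : degMax S * γ < 1 - 6 * (degMax S * ι)) :
    ∃ Q : Matrix (Fin n) (Fin n) ℝ, (∀ i j, S i j ≠ 0 → Q i j = γ * SignType.sign (S i j)) ∧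
      (∀ i j, S i j = 0 → |Q i j| < γ) ∧ Q - tangentProj P Q = Q - G ∧ ‖Q - G‖ < 1 := by
  have hγ0 : 0 < γ := by
    by_contra h
    nlinarith
  -- The certificate will be `Z + N`, with `Z` on the support and `N` in `T`. Requiring tangent part
  -- `G` forces `N = G - tangentProj P Z`; the prescribed values on the support then give this
  -- equation for `Z`.
  obtain ⟨Z, hZ⟩ := exists_eq_add_restrictSupport_tangentProj (S := S) hsym hidem hι hP
    (by linarith)
    ((Matrix.of fun i j => γ * (SignType.sign (S i j) : ℝ)) - restrictSupport S G)
  set N := G - tangentProj P Z with hN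
  have hGT : tangentProj P G = G := by
    rw [tangentProj_apply, sub_mul, hPG, one_mul, sub_self, Matrix.zero_mul, add_zero]
  have hNT : tangentProj P N = N := by
    rw [hN, map_sub, hGT, tangentProj_tangentProj hidem]
  have hZon : ∀ i j, S i j ≠ 0 → Z i j = γ * SignType.sign (S i j) - N i j := by
    intro i j h
    have := congrFun (congrFun hZ i) j
    simp only [Matrix.add_apply, Matrix.sub_apply, Matrix.of_apply, restrictSupport_apply, h,
      if_false] at this
    rw [this, hN, Matrix.sub_apply]
    ring
  have hZoff : ∀ i j, S i j = 0 → Z i j = 0 := by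
    intro i j h
    have := congrFun (congrFun hZ i) j
    simpa [restrictSupport_apply, h] using this
  set a := maxEntry Z with ha
  have ha0 : 0 ≤ a := maxEntry_nonneg Z
  have hZn : ‖Z‖ ≤ degMax S * a := norm_le_of_sparse ha0 (abs_le_maxEntry Z) hZoff
  have hNn : ‖N‖ ≤ 1 + 2 * (degMax S * a) := by
    have h1 := norm_tangentProj_le hsym hidem Z
    have h2 := norm_sub_le G (tangentProj P Z)
    linarith
  have hNe : ∀ i j, |N i j| ≤ 2 * ι * (1 + 2 * (degMax S * a)) := fun i j =>
    (abs_tangentProj_le hsym hidem hι hP hNT i j).trans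
      (mul_le_mul_of_nonneg_left hNn (by positivity))
  have hale : a ≤ γ + 2 * ι * (1 + 2 * (degMax S * a)) := by
    refine maxEntry_le (by positivity) fun i j => ?_
    by_cases h : S i j = 0
    · rw [hZoff i j h, abs_zero]; positivity
    · rw [hZon i j h]
      have hs : |γ * (SignType.sign (S i j) : ℝ)| = γ := by
        rw [abs_mul, abs_of_pos hγ0]
        rcases lt_or_gt_of_ne h with h | h <;> simp [h]
      linarith [abs_sub (γ * (SignType.sign (S i j) : ℝ)) (N i j), hNe i j]
  set x := (degMax S : ℝ) * ι with hx
  have hx0 : 0 ≤ x := by positivity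
  have hale' : a * (1 - 4 * x) ≤ γ + 2 * ι := by
    have : 2 * ι * (1 + 2 * (degMax S * a)) = 2 * ι + 4 * x * a := by rw [hx]; ring
    rw [this] at hale
    linarith
  -- The upper end of the interval enters here: `d γ + 2x < 1 - 4x`.
  have hda : (degMax S : ℝ) * a < 1 := by
    have h1 : (degMax S : ℝ) * a * (1 - 4 * x) ≤ degMax S * γ + 2 * x := by
      have := mul_le_mul_of_nonneg_left hale' (Nat.cast_nonneg (α := ℝ) (degMax S))
      rw [hx] at this ⊢
      linarith
    by_contra hcon
    nlinarith
  -- After multiplication by `1 - 4x` the claim reduces to `2ι + 4xγ < γ(1 - 4x)`, which is the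
  -- lower end of the interval.
  have hoff : 2 * ι * (1 + 2 * (degMax S * a)) < γ := by
    have h1 : 2 * ι * (1 + 2 * (degMax S * a)) = 2 * ι + 4 * x * a := by rw [hx]; ring
    have h2 : x * (a * (1 - 4 * x)) ≤ x * (γ + 2 * ι) := mul_le_mul_of_nonneg_left hale' hx0
    rw [h1]
    have h3 : (2 * ι + 4 * x * a) * (1 - 4 * x) < γ * (1 - 4 * x) := by linarith
    exact lt_of_mul_lt_mul_right h3 (by linarith)
  have hQG : Z + N - G = Z - tangentProj P Z := by rw [hN]; abel
  refine ⟨Z + N, fun i j h => ?_, fun i j h => ?_, ?_, ?_⟩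
  · rw [Matrix.add_apply, hZon i j h]; ring
  · rw [Matrix.add_apply, hZoff i j h, zero_add]
    exact (hNe i j).trans_lt hoff
  · rw [map_add, hNT, hQG]; abel
  · rw [hQG]
    exact (norm_sub_tangentProj_le hsym hidem Z).trans_lt (hZn.trans_lt hda)

end Certificate

/-! ### Strict optimality from a certificate. -/

section Optimality

variable {n : ℕ}

theorem trace_transpose_mul_eq_sum (A B : Matrix (Fin n) (Fin n) ℝ) :
    (Aᵀ * B).trace = ∑ i, ∑ j, A i j * B i j := by
  rw [trace, Finset.sum_comm]
  simp [mul_apply]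

/-- A strict dual certificate forces a strict increase of the objective. -/
theorem objective_lt_of_dual_certificate {S L G P Q D : Matrix (Fin n) (Fin n) ℝ} {γ : ℝ}
    (hγ : 0 < γ) (hsym : Pᵀ = P) (hidem : P * P = P) (hPL : P * L = L) (hPG : P * G = G)
    (hGP : G * P = G) (hG : ‖G‖ ≤ 1) (hGL : (Gᵀ * L).trace = nuclearNorm L)
    (hon : ∀ i j, S i j ≠ 0 → Q i j = γ * SignType.sign (S i j))
    (hoff : ∀ i j, S i j = 0 → |Q i j| < γ)
    (hQT : Q - tangentProj P Q = Q - G) (hQ : ‖Q - G‖ < 1)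
    (htrans : (∀ i j, S i j = 0 → D i j = 0) → tangentProj P D = D → D = 0) (hD : D ≠ 0) :
    objective γ (S, L) < objective γ (S + D, L - D) := by
  set E := D - tangentProj P D with hE
  have hE' : E = (1 - P) * D * (1 - P) := sub_tangentProj P D
  have hP1 : P * (1 - P) = 0 := by rw [mul_sub, mul_one, hidem, sub_self]
  have h1P : (1 - P) * P = 0 := by rw [sub_mul, one_mul, hidem, sub_self]
  have hPperp : ∀ M, P * ((1 - P) * M * (1 - P)) = 0 := fun M => by
    rw [← mul_assoc, ← mul_assoc, hP1, zero_mul, zero_mul]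
  have hperpP : ∀ M, ((1 - P) * M * (1 - P)) * P = 0 := fun M => by
    rw [mul_assoc, h1P, mul_zero]
  have hQG' : Q - G = (1 - P) * Q * (1 - P) := by rw [← hQT, sub_tangentProj]
  -- The slack in `‖Q - G‖ < 1` allows a tilt by `-ε • E` within the unit ball, which gains `ε`
  -- times the squared Frobenius norm of `E`.
  obtain ⟨ε, hε, hεE⟩ : ∃ ε : ℝ, 0 < ε ∧ ε * ‖E‖ ≤ 1 - ‖Q - G‖ := by
    refine ⟨(1 - ‖Q - G‖) / (‖E‖ + 1), div_pos (by linarith) (by positivity), ?_⟩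
    rw [div_mul_eq_mul_div, div_le_iff₀ (by positivity)]
    nlinarith [norm_nonneg E]
  have hW1 : ‖Q - G - ε • E‖ ≤ 1 := by
    have h1 := norm_sub_le (Q - G) (ε • E)
    have h2 : ‖ε • E‖ ≤ ε * ‖E‖ := by
      rw [norm_smul, Real.norm_of_nonneg hε.le]
    linarith
  have hPW : P * (Q - G - ε • E) = 0 := by
    rw [mul_sub, hQG', hE', Matrix.mul_smul, hPperp, hPperp, smul_zero, sub_zero]
  have hWP : (Q - G - ε • E) * P = 0 := by
    rw [sub_mul, hQG', hE', Matrix.smul_mul, hperpP, hperpP, smul_zero, sub_zero]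
  have hnuc := trace_transpose_mul_le_nuclearNorm
    (norm_add_le_one_of_block hsym hidem hPG hGP hPW hWP hG hW1) (L - D)
  have hWL : (Q - G - ε • E)ᵀ * L = 0 := by
    have : (Q - G - ε • E)ᵀ * P = 0 := by
      rw [← hsym, ← transpose_mul, hPW, transpose_zero]
    rw [← hPL, ← mul_assoc, this, zero_mul]
  -- `E` is the orthogonal projection of `D` onto the complement of `T`.
  have hED : (Eᵀ * D).trace = ∑ i, ∑ j, E i j ^ 2 := by
    have h1 : (Eᵀ * E).trace = (Eᵀ * D).trace := by
      have hEP : (1 - P) * E * (1 - P) = E := by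
        rw [hE', ← mul_assoc, ← mul_assoc, one_sub_mul_one_sub hidem, mul_assoc,
          one_sub_mul_one_sub hidem]
      calc (Eᵀ * E).trace = (Eᵀ * ((1 - P) * D * (1 - P))).trace := by rw [← hE']
        _ = ((1 - P) * (Eᵀ * ((1 - P) * D))).trace := by
            rw [← mul_assoc, trace_mul_comm]
        _ = (((1 - P) * E * (1 - P))ᵀ * D).trace := by
            rw [transpose_mul, transpose_mul, one_sub_transpose hsym]
            simp only [mul_assoc]
        _ = _ := by rw [hEP]
    rw [← h1, trace_transpose_mul_eq_sum]
    simp only [sq]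
  have hnuc' : nuclearNorm L - ∑ i, ∑ j, Q i j * D i j + ε * ∑ i, ∑ j, E i j ^ 2
      ≤ nuclearNorm (L - D) := by
    have h1 : G + (Q - G - ε • E) = Q - ε • E := by abel
    have h2 : (G + (Q - G - ε • E))ᵀ * L = Gᵀ * L := by
      rw [transpose_add, add_mul, hWL, add_zero]
    have h3 : ((G + (Q - G - ε • E))ᵀ * D).trace
        = ∑ i, ∑ j, Q i j * D i j - ε * ∑ i, ∑ j, E i j ^ 2 := by
      rw [h1, transpose_sub, transpose_smul, sub_mul, trace_sub, Matrix.smul_mul, trace_smul, hED,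
        trace_transpose_mul_eq_sum, smul_eq_mul]
    rw [mul_sub, trace_sub, h2, hGL, h3] at hnuc
    linarith
  have hentry : ∀ i j, 0 ≤ γ * |S i j + D i j| - γ * |S i j| - Q i j * D i j := by
    intro i j
    by_cases h : S i j = 0
    · rw [h, zero_add, abs_zero, mul_zero, sub_zero]
      have h1 : Q i j * D i j ≤ |Q i j| * |D i j| := by rw [← abs_mul]; exact le_abs_self _
      have h2 := mul_le_mul_of_nonneg_right (hoff i j h).le (abs_nonneg (D i j))
      linarith
    · rw [hon i j h]
      rcases lt_or_gt_of_ne h with h | h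
      · rw [sign_neg h, abs_of_neg h]
        have := mul_le_mul_of_nonneg_left (neg_abs_le (S i j + D i j)) hγ.le
        simp only [SignType.coe_neg, SignType.coe_one]
        linarith
      · rw [sign_pos h, abs_of_pos h]
        have := mul_le_mul_of_nonneg_left (le_abs_self (S i j + D i j)) hγ.le
        simp only [SignType.coe_one]
        linarith
  have hl1 : γ * l1Norm (S + D) - γ * l1Norm S - ∑ i, ∑ j, Q i j * D i j =
      ∑ i, ∑ j, (γ * |S i j + D i j| - γ * |S i j| - Q i j * D i j) := by
    simp only [l1Norm, Finset.mul_sum, Finset.sum_sub_distrib, Matrix.add_apply]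
  have hE0 : 0 ≤ ∑ i, ∑ j, E i j ^ 2 :=
    Finset.sum_nonneg fun _ _ => Finset.sum_nonneg fun _ _ => sq_nonneg _
  have hl0 := Finset.sum_nonneg fun i (_ : i ∈ Finset.univ) =>
    Finset.sum_nonneg fun j (_ : j ∈ Finset.univ) => hentry i j
  have hεE0 : 0 ≤ ε * ∑ i, ∑ j, E i j ^ 2 := mul_nonneg hε.le hE0
  unfold objective
  by_contra! hle
  dsimp only at hle
  have hEz : ∑ i, ∑ j, E i j ^ 2 = 0 := by
    have : ε * ∑ i, ∑ j, E i j ^ 2 = 0 := by linarith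
    exact (mul_eq_zero.1 this).resolve_left hε.ne'
  have hlz : ∑ i, ∑ j, (γ * |S i j + D i j| - γ * |S i j| - Q i j * D i j) = 0 := by linarith
  -- Both nonnegative gaps vanish: the entrywise one puts `D` on the support of `S`, and `E = 0`
  -- puts it in `T`.
  refine hD (htrans (fun i j h => ?_) ?_)
  · have h1 := (Finset.sum_eq_zero_iff_of_nonneg fun i _ =>
      Finset.sum_nonneg fun j _ => hentry i j).1 hlz i (Finset.mem_univ i)
    have h2 := (Finset.sum_eq_zero_iff_of_nonneg fun j _ => hentry i j).1 h1 j (Finset.mem_univ j)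
    rw [h, zero_add, abs_zero, mul_zero, sub_zero] at h2
    by_contra hne
    have h3 : Q i j * D i j ≤ |Q i j| * |D i j| := by rw [← abs_mul]; exact le_abs_self _
    have h4 := mul_lt_mul_of_pos_right (hoff i j h) (abs_pos.2 hne)
    linarith
  · have hE00 : E = 0 := by
      ext i j
      have h1 := (Finset.sum_eq_zero_iff_of_nonneg fun i _ =>
        Finset.sum_nonneg fun j _ => sq_nonneg (E i j)).1 hEz i (Finset.mem_univ i)
      have h2 := (Finset.sum_eq_zero_iff_of_nonneg fun j _ => sq_nonneg (E i j)).1 h1 j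
        (Finset.mem_univ j)
      simpa using h2
    exact (sub_eq_zero.1 hE00).symm

end Optimality

/-! ### Arithmetic of the penalty interval. -/

section PenaltyRange

variable {n : ℕ}

theorem penaltyRange_nonempty {S L : Matrix (Fin n) (Fin n) ℝ}
    (h : (degMax S : ℝ) * inc L < 1 / 12) : (penaltyRange S L).Nonempty := by
  by_cases hd : degMax S = 0
  · exact ⟨2 * inc L / (1 - 8 * degMax S * inc L) + 1, by simp, fun h => absurd hd h⟩
  · have hd0 : (0 : ℝ) < degMax S := by exact_mod_cast Nat.pos_of_ne_zero hd
    have hlt : 2 * inc L / (1 - 8 * degMax S * inc L)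
        < (1 - 6 * degMax S * inc L) / degMax S := by
      rw [div_lt_div_iff₀ (by linarith) hd0]
      -- With `x = dι` this is `(1 - 4x)(1 - 12x) > 0`, hence the constant 1/12.
      nlinarith
    obtain ⟨γ, h1, h2⟩ := exists_between hlt
    exact ⟨γ, h1, fun _ => h2⟩

theorem mem_penaltyRange_bounds {S L : Matrix (Fin n) (Fin n) ℝ} {γ : ℝ}
    (h : (degMax S : ℝ) * inc L < 1 / 12) (hγ : γ ∈ penaltyRange S L) :
    2 * inc L < γ * (1 - 8 * (degMax S * inc L)) ∧
      degMax S * γ < 1 - 6 * (degMax S * inc L) := by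
  obtain ⟨h1, h2⟩ := hγ
  constructor
  · rw [div_lt_iff₀ (by linarith)] at h1
    linarith
  · by_cases hd : degMax S = 0
    · simp [hd]
    · have hd0 : (0 : ℝ) < degMax S := by exact_mod_cast Nat.pos_of_ne_zero hd
      have := h2 hd
      rw [lt_div_iff₀ hd0] at this
      linarith

end PenaltyRange

end SparseLowRank

/-! ### The main theorem. -/

open Matrix SparseLowRank in
theorem lemma4 {n : ℕ} (S₀ L₀ C : Matrix (Fin n) (Fin n) ℝ)
    (hS : SparseLowRank.IsSkew S₀) (hL : SparseLowRank.IsSkew L₀) (hC : C = S₀ + L₀)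
    (hdeg : (SparseLowRank.degMax S₀ : ℝ) * SparseLowRank.inc L₀ < 1 / 12) :
    (SparseLowRank.penaltyRange S₀ L₀).Nonempty ∧
      ∀ γ ∈ SparseLowRank.penaltyRange S₀ L₀,
        SparseLowRank.optimalSet γ C = {(S₀, L₀)} := by
  refine ⟨penaltyRange_nonempty hdeg, fun γ hγ => ?_⟩
  obtain ⟨hγ1, hγ2⟩ := mem_penaltyRange_bounds hdeg hγ
  obtain ⟨P, hsym, hidem, hPL, hP⟩ := exists_columnSpace_projection L₀
  obtain ⟨G, hG, hGL, ⟨A, hA⟩, ⟨B, hB⟩⟩ := exists_polar_factor L₀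
  have hι := inc_nonneg L₀
  have hγ0 : 0 < γ := by
    by_contra h
    nlinarith
  have hLT : L₀ᵀ = -L₀ := (neg_eq_of_add_eq_zero_right hL).symm
  -- Transposing `P * L₀ = L₀` and using skewness shows that `P` also fixes `L₀` from the right.
  have hLP : L₀ * P = L₀ := by
    have h := congrArg transpose hPL
    rw [transpose_mul, hsym, hLT, Matrix.neg_mul] at h
    exact neg_injective h
  have hPG : P * G = G := by rw [hA, ← Matrix.mul_assoc, hPL]
  have hGP : G * P = G := by rw [hB, Matrix.mul_assoc, hLP]
  obtain ⟨Q, hon, hoff, hQT, hQ⟩ :=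
    exists_dual_certificate hsym hidem hι hP hPG hG hdeg hγ1 hγ2
  have hlt : ∀ q ∈ feasibleSet C, q ≠ (S₀, L₀) → objective γ (S₀, L₀) < objective γ q := by
    rintro ⟨S, L⟩ ⟨hq, -, -⟩ hne
    obtain ⟨D, rfl⟩ : ∃ D, S = S₀ + D := ⟨S - S₀, (add_sub_cancel S₀ S).symm⟩
    obtain rfl : L = L₀ - D := by
      have h : S₀ + D + L = S₀ + L₀ := hq.trans hC
      rw [add_assoc] at h
      rw [← add_left_cancel h, add_sub_cancel_left]
    have hD : D ≠ 0 := by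
      rintro rfl
      exact hne (by rw [add_zero, sub_zero])
    exact objective_lt_of_dual_certificate hγ0 hsym hidem hPL hPG hGP hG hGL hon hoff hQT hQ
      (eq_zero_of_support_of_tangentProj hsym hidem hι hP (by linarith)) hD
  have hfeas : (S₀, L₀) ∈ feasibleSet C := ⟨hC.symm, hS, hL⟩
  ext q
  rw [Set.mem_singleton_iff]
  constructor
  · rintro ⟨hq, hmin⟩
    by_contra hne
    exact (hlt q hq hne).not_ge (hmin _ hfeas)
  · rintro rfl
    refine ⟨hfeas, fun q hq => ?_⟩
    by_cases hne : q = (S₀, L₀)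
    · rw [hne]
    · exact (hlt q hq hne).le
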